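/- Let $h:\mathbb{R}^d\to\mathbb{R}^d$ be $C^2$, let $a_0,a_1,\dots>0$, and let $x_0, M_1, M_2,\dots$ be $\mathbb{R}^d$-valued random variables on a probability space such that, with $\mathcal{F}_k=\sigma(x_0,M_1,\dots,M_k)$, each $M_{k+1}$ is integrable and $\mathbb{E}[M_{k+1}\mid\mathcal{F}_k]=0$ a.s. Let $$x_{k+1}=x_k+a_k\,[h(x_k)+M_{k+1}],\qquad t_0=0,\quad t_{k+1}=t_k+a_k,$$ and let $\bar x$ be the piecewise linear interpolation with $\bar x(t_k)=x_k$, i.e. $\bar x(t)=x_k+\frac{t-t_k}{a_k}(x_{k+1}-x_k)$ for $t\in[t_k,t_{k+1}]$. Let $x(\cdot,s,u)$ denote the solution of $\dot x=h(x)$ with $x(s,s,u)=u$, and let $\Phi(\cdot,s,u)$ be the fundamental matrix of $\dot y(t)=Dh(x(t,s,u))\,y(t)$, $t\ge s$, with $\Phi(s,s,u)=\mathbb{I}_d$ (both $x(\cdot,s,u)$ and $\Phi(\cdot,s,u)$ are defined on $[s,T]$ as soon as a solution from $u$ at time $s$ exists on $[s,T]$). Fix $n\ge n_0\ge 0$ and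 put $$W_n=\sum_{k=n_0}^{n-1}\int_{t_k}^{t_{k+1}}\Phi(t_n,s,\bar x(s))\,[h(\bar x(t_k))-h(\bar x(s))]\,ds,$$ $$\tilde S_n=\sum_{k=n_0}^{n-1}\int_{t_k}^{t_{k+1}}\Phi(t_n,s,\bar x(s))\,ds\,M_{k+1},\qquad S_n=\sum_{k=n_0}^{n-1}\xi_k,\quad \xi_k=\int_{t_k}^{t_{k+1}}\Phi(t_n,s,\bar x(t_k))\,ds\,M_{k+1}.$$ 1. For every outcome such that, for each $s\in[t_{n_0},t_n]$, the solution of $\dot x=h(x)$ starting from $\bar x(s)$ at time $s$ exists on $[s,t_n]$, all the integrands above are integrable and $$\bar x(t_n)=x(t_n,t_{n_0},\bar x(t_{n_0}))+W_n+S_n+(\tilde S_n-S_n).$$ 2. $S_n$ is a sum of martingale differences with respect to $(\mathcal{F}_k)$, in the following sense. For $n_0\le k<n$ let $D_k$ be the event that the solution starting from $x_k$ at time $t_k$ exists on $[t_k,t_n]$. If $A_k\in\mathcal{F}_k$, $A_k\subseteq D_k$ and $1_{A_k}\xi_k$ is integrable for $n_0\le k<n$, then $1_{A_k}\xi_k$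 is $\mathcal{F}_{k+1}$-measurable with $\mathbb{E}[1_{A_k}\xi_k\mid\mathcal{F}_k]=0$ a.s., and the sums $\sum_{n_0\le k<\min(l,n)}1_{A_k}\xi_k$, $l\ge 0$, form a martingale with respect to $(\mathcal{F}_l)$ (so if all $D_k$ are the whole space and all $\xi_k$ are integrable, one may take all $A_k$ to be the whole space). Moreover, $1_A\xi_k$ is integrable whenever $A\in\mathcal{F}_k$ and, on $A$, $x_k$ lies in a compact set of points from which the solution started at time $t_k$ exists on $[t_k,t_n]$; and $D_k$ is the union of an increasing sequence of events $B_j\in\mathcal{F}_k$ for which $1_{B_j}\xi_k$ is integrable. -/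

import Mathlib

open MeasureTheory ProbabilityTheory Set
open scoped BigOperators

noncomputable section

/-- `ℝ^d` with its Euclidean norm. -/
abbrev Vec (d : ℕ) : Type := EuclideanSpace ℝ (Fin d)

/-! ### The limiting ODE and its variational equation -/

/-- `y` solves `ẏ = h(y)` on the interval `[s, T]` with `y(s) = u`
(one-sided derivatives at the end points). -/
def IsODESolution {d : ℕ} (h : Vec d → Vec d) (s T : ℝ) (u : Vec d) (y : ℝ → Vec d) : Prop :=
  y s = u ∧ ∀ t ∈ Icc s T, HasDerivWithinAt y (h (y t)) (Icc s T) t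

/-- The ODE `ẏ = h(y)` has a solution on `[s, T]` with `y(s) = u`. -/
def HasODESolution {d : ℕ} (h : Vec d → Vec d) (s T : ℝ) (u : Vec d) : Prop :=
  ∃ y : ℝ → Vec d, IsODESolution h s T u y

open Classical in
/-- `x(t, s, u)`: the value at time `t` of the solution of `ẏ = h(y)` with `y(s) = u`
(by convention `0` if no solution exists on `[s, t]`). -/
def odeSol {d : ℕ} (h : Vec d → Vec d) (t s : ℝ) (u : Vec d) : Vec d :=
  if H : HasODESolution h s t u then Classical.choose H t else 0

/-- `Y` solves on `[s, T]` the matrix form `Ẏ(τ) = Dh(x(τ, s, u)) Y(τ)`, `Y(s) = I`, of the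
variational equation along the solution started from `u` at time `s`; `d × d` matrices are
viewed as linear maps of `ℝ^d`. -/
def IsFundamentalSolution {d : ℕ} (h : Vec d → Vec d) (s T : ℝ) (u : Vec d)
    (Y : ℝ → (Vec d →L[ℝ] Vec d)) : Prop :=
  Y s = ContinuousLinearMap.id ℝ (Vec d) ∧
    ∀ τ ∈ Icc s T,
      HasDerivWithinAt Y ((fderiv ℝ h (odeSol h τ s u)).comp (Y τ)) (Icc s T) τ

open Classical in
/-- `Φ(t, s, u)`: the fundamental matrix of the variational equation, normalised to be the
identity at time `s`. -/
def fundMatrix {d : ℕ} (h : Vec d → Vec d) (t s : ℝ) (u : Vec d) : Vec d →L[ℝ] Vec d :=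
  if H : ∃ Y : ℝ → (Vec d →L[ℝ] Vec d), IsFundamentalSolution h s t u Y then
    Classical.choose H t
  else 0

/-! ### The stochastic approximation scheme, path by path -/

/-- The iterates `x_{n+1} = x_n + a_n (h(x_n) + M_{n+1})`. -/
def saIterate {d : ℕ} (h : Vec d → Vec d) (a : ℕ → ℝ) (x₀ : Vec d) (m : ℕ → Vec d) :
    ℕ → Vec d
  | 0 => x₀
  | n + 1 =>
      saIterate h a x₀ m n + a n • (h (saIterate h a x₀ m n) + m (n + 1))

/-- `t_0 = 0`, `t_{n+1} = t_n + a_n`. -/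
def saTime (a : ℕ → ℝ) (n : ℕ) : ℝ := ∑ i ∈ Finset.range n, a i

open Classical in
/-- The linear interpolation `x̄` of a sequence `x`, with `x̄(t_n) = x_n`: when
`t_n ≤ s < t_{n+1}`, the index found below is `n`. -/
def saInterp {d : ℕ} (a : ℕ → ℝ) (x : ℕ → Vec d) (s : ℝ) : Vec d :=
  if H : ∃ n, s < saTime a (n + 1) then
    x (Nat.find H) +
      ((s - saTime a (Nat.find H)) / a (Nat.find H)) • (x (Nat.find H + 1) - x (Nat.find H))
  else 0

/-- `W_n`, the discretization error. -/
def discTerm {d : ℕ} (h : Vec d → Vec d) (a : ℕ → ℝ) (x : ℕ → Vec d) (n₀ n : ℕ) : Vec d :=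
  ∑ k ∈ Finset.Ico n₀ n, ∫ s in (saTime a k)..(saTime a (k + 1)),
    fundMatrix h (saTime a n) s (saInterp a x s)
      (h (saInterp a x (saTime a k)) - h (saInterp a x s))

/-- `S̃_n`, the noise term along the interpolated path. -/
def noiseTerm {d : ℕ} (h : Vec d → Vec d) (a : ℕ → ℝ) (x m : ℕ → Vec d) (n₀ n : ℕ) : Vec d :=
  ∑ k ∈ Finset.Ico n₀ n,
    (∫ s in (saTime a k)..(saTime a (k + 1)),
      fundMatrix h (saTime a n) s (saInterp a x s)) (m (k + 1))

/-- The `k`-th summand of `S_n`. -/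
def mgDiff {d : ℕ} (h : Vec d → Vec d) (a : ℕ → ℝ) (x m : ℕ → Vec d) (n k : ℕ) : Vec d :=
  (∫ s in (saTime a k)..(saTime a (k + 1)),
    fundMatrix h (saTime a n) s (saInterp a x (saTime a k))) (m (k + 1))

/-- `S_n`, the noise term with the starting points frozen at the grid points. -/
def mgTerm {d : ℕ} (h : Vec d → Vec d) (a : ℕ → ℝ) (x m : ℕ → Vec d) (n₀ n : ℕ) : Vec d :=
  ∑ k ∈ Finset.Ico n₀ n, mgDiff h a x m n k

/-! ### The filtration of the scheme -/

/-- `F_n = σ(x_0, M_1, …, M_n)`. -/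
def saFiltration {d : ℕ} {Ω : Type*} [mΩ : MeasurableSpace Ω] (x₀ : Ω → Vec d)
    (M : ℕ → Ω → Vec d) (hx₀ : Measurable x₀) (hM : ∀ n, Measurable (M (n + 1))) :
    Filtration ℕ mΩ where
  seq n := MeasurableSpace.comap x₀ inferInstance ⊔
    ⨆ i : ℕ, ⨆ _ : i < n, MeasurableSpace.comap (M (i + 1)) inferInstance
  mono' := fun _ _ hmn => sup_le_sup le_rfl
    (iSup_mono fun _ => iSup_mono' fun hi => ⟨lt_of_lt_of_le hi hmn, le_rfl⟩)
  le' := fun _ => sup_le hx₀.comap_le (iSup_le fun i => iSup_le fun _ => (hM i).comap_le)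

end

/-!
The pathwise identity is Alekseev's nonlinear variation of constants formula. Follow the
interpolated path `x̄` and, from each of its points `x̄(s)`, run the flow to the fixed final
time `t_n`: the curve `s ↦ x(t_n, s, x̄(s))` ends at `x̄(t_n)` and begins at
`x(t_n, t_{n₀}, x̄(t_{n₀}))`, and its derivative is `Φ(t_n, s, x̄(s))` applied to the defect
`x̄'(s) - h(x̄(s))`. On the `k`-th step the slope of `x̄` is `h(x_k) + M_{k+1}`, so the integral of
the derivative splits into the summands of `W_n` and `S̃_n`.

Computing that derivative needs no differentiability of `x(t, s, u)` in the pair `(s, u)`.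
By the semigroup property the flow from `x̄(s)` can be restarted at a slightly later time `r`, so
one only compares two starting points at the same time `r`, and for this a first order expansion
in the starting point with a quadratic remainder suffices (`hasDerivWithinAt_odeSol_comp`). A right
derivative is all that results, and all that the fundamental theorem of calculus needs.

The expansion, and the continuity of `x` and `Φ` in time and starting point, are local properties
(`HasODESolution.exists_local_flow`). They are proved first for a field with compact support
(`exists_flow_estimates`), where solutions exist for all time, `h` and `Dh` are globally Lipschitz
and each bound is a Grönwall inequality, and then carried over by multiplying `h` by a bump
function that is `1` around the trajectory. In particular the set of starting points whose solution
lives up to a given time is open.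

For the probabilistic part, `x_k` is `𝓕_k`-measurable and the matrix multiplying `M_{k+1}` in the
`k`-th summand of `S_n` is a continuous function of `x_k` on that open set. It is therefore pulled
out of the conditional expectation given `𝓕_k`, and it is bounded on compact sets, which exhaust
the open set.
-/

/-! ### Linear and bounded Lipschitz differential equations -/

section OrdinaryDifferentialEquations

open Filter Topology NNReal

variable {E : Type*} [NormedAddCommGroup E] [NormedSpace ℝ E]

theorem HasDerivWithinAt.Ici_of_Icc {f : ℝ → E} {f' : E} {a b t : ℝ}
    (hf : HasDerivWithinAt f f' (Icc a b) t) (ht : t ∈ Ico a b) :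
    HasDerivWithinAt f f' (Ici t) t :=
  hf.mono_of_mem_nhdsWithin (Icc_mem_nhdsGE_of_mem ht)

theorem norm_le_gronwallBound_of_hasDerivWithinAt_Icc {f f' : ℝ → E} {δ K ε a b : ℝ}
    (hf : ∀ t ∈ Icc a b, HasDerivWithinAt f (f' t) (Icc a b) t) (h0 : ‖f a‖ ≤ δ)
    (bound : ∀ t ∈ Icc a b, ‖f' t‖ ≤ K * ‖f t‖ + ε) :
    ∀ t ∈ Icc a b, ‖f t‖ ≤ gronwallBound δ K ε (t - a) :=
  norm_le_gronwallBound_of_norm_deriv_right_le (fun t ht => (hf t ht).continuousWithinAt)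
    (fun t ht => (hf t (Ico_subset_Icc_self ht)).Ici_of_Icc ht) h0
    (fun t ht => bound t (Ico_subset_Icc_self ht))

theorem gronwallBound_zero_left_eq_mul (K ε x : ℝ) :
    gronwallBound 0 K ε x = ε * gronwallBound 0 K 1 x := by
  by_cases hK : K = 0
  · subst hK; simp [gronwallBound_K0]
  · simp only [gronwallBound_of_K_ne_0 hK]; ring

theorem HasDerivWithinAt.comp_sub_const_Icc {f : ℝ → E} {f' : E} {a b c t : ℝ}
    (hf : HasDerivWithinAt f f' (Icc a b) (t - c)) :
    HasDerivWithinAt (fun τ => f (τ - c)) f' (Icc (a + c) (b + c)) t := by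
  have h1 : HasDerivWithinAt (fun τ : ℝ => τ - c) 1 (Icc (a + c) (b + c)) t :=
    ((hasDerivAt_id t).sub_const c).hasDerivWithinAt
  have := HasDerivWithinAt.scomp (h := fun τ : ℝ => τ - c) t hf h1
    (fun τ hτ => ⟨by linarith [hτ.1], by linarith [hτ.2]⟩)
  simpa using! this

/-- A bounded and globally Lipschitz time-dependent vector field has a trajectory from every point
over the whole time interval: Picard-Lindelöf applies on a ball too large to be left in time. -/
theorem exists_hasDerivWithinAt_of_bounded_lipschitz [CompleteSpace E] {f : ℝ → E → E}
    {s T : ℝ} (hsT : s ≤ T) {K L : ℝ≥0} (hlip : ∀ t ∈ Icc s T, LipschitzWith K (f t))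
    (hcont : ∀ x, ContinuousOn (f · x) (Icc s T)) (hbdd : ∀ t ∈ Icc s T, ∀ x, ‖f t x‖ ≤ L)
    (u : E) :
    ∃ y : ℝ → E, y s = u ∧ ∀ t ∈ Icc s T, HasDerivWithinAt y (f t (y t)) (Icc s T) t := by
  have hP : IsPicardLindelof f (⟨s, left_mem_Icc.2 hsT⟩ : Icc s T) u
      (L * (T - s).toNNReal) 0 L K :=
    { lipschitzOnWith := fun t ht => (hlip t ht).lipschitzOnWith
      continuousOn := fun x _ => hcont x
      norm_le := fun t ht x _ => hbdd t ht x
      mul_max_le := by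
        have hmax : max (T - s) (s - s) = T - s := by simp [hsT]
        rw [hmax, NNReal.coe_zero, sub_zero, NNReal.coe_mul,
          Real.coe_toNNReal _ (sub_nonneg.2 hsT)] }
  exact hP.exists_eq_forall_mem_Icc_hasDerivWithinAt₀

/-- A linear equation with continuous coefficients is solvable over the whole time interval.
Multiplying the unknown by a bump function makes the field bounded, and by Grönwall the bump is
never felt if its plateau is large enough. -/
theorem exists_hasDerivWithinAt_linear [FiniteDimensional ℝ E] {A : ℝ → E →L[ℝ] E} {s T : ℝ}
    (hsT : s ≤ T) (hA : ContinuousOn A (Icc s T)) (u : E) :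
    ∃ y : ℝ → E, y s = u ∧ ∀ t ∈ Icc s T, HasDerivWithinAt y (A t (y t)) (Icc s T) t := by
  obtain ⟨C, hC⟩ := isCompact_Icc.exists_bound_of_continuousOn hA
  have hC0 : 0 ≤ C := (norm_nonneg _).trans (hC s (left_mem_Icc.2 hsT))
  set R : ℝ := ‖u‖ * Real.exp (C * (T - s)) + 1 with hR
  have hRpos : 0 < R := by positivity
  let χ : ContDiffBump (0 : E) := ⟨R, R + 1, hRpos, by linarith⟩
  have hχsupp : HasCompactSupport fun z : E => χ z • z :=
    χ.hasCompactSupport.smul_right (f' := fun z : E => z)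
  have hχdiff : ContDiff ℝ 1 fun z : E => χ z • z := χ.contDiff.smul contDiff_id
  obtain ⟨K, hK⟩ := hχdiff.lipschitzWith_of_hasCompactSupport hχsupp one_ne_zero
  obtain ⟨B, hB⟩ := hχdiff.continuous.norm.bddAbove_range_of_hasCompactSupport hχsupp.norm
  have hB' : ∀ z : E, ‖χ z • z‖ ≤ B := fun z => hB ⟨z, rfl⟩
  have hB0 : 0 ≤ B := (norm_nonneg _).trans (hB' 0)
  obtain ⟨y, hy0, hy⟩ := exists_hasDerivWithinAt_of_bounded_lipschitz
    (f := fun t z => A t (χ z • z)) (K := ⟨C, hC0⟩ * K) (L := ⟨C * B, by positivity⟩) hsT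
    (fun t ht => by
      refine LipschitzWith.comp (Kf := ⟨C, hC0⟩) (f := A t) ?_ hK
      exact (A t).lipschitz.weaken (by exact_mod_cast hC t ht))
    (fun z => hA.clm_apply continuousOn_const)
    (fun t ht z => ((A t).le_opNorm _).trans
      (mul_le_mul (hC t ht) (hB' z) (norm_nonneg _) hC0)) u
  have hbound := norm_le_gronwallBound_of_hasDerivWithinAt_Icc (K := C) (ε := 0) hy le_rfl
    (fun t ht => by
      rw [add_zero]
      refine ((A t).le_opNorm _).trans (mul_le_mul (hC t ht) ?_ (norm_nonneg _) hC0)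
      rw [norm_smul, Real.norm_of_nonneg χ.nonneg]
      exact mul_le_of_le_one_left (norm_nonneg _) χ.le_one)
  refine ⟨y, hy0, fun t ht => ?_⟩
  have hyR : ‖y t‖ ≤ R := by
    refine (hbound t ht).trans ?_
    rw [gronwallBound_ε0, hy0]
    have : Real.exp (C * (t - s)) ≤ Real.exp (C * (T - s)) :=
      Real.exp_le_exp.2 (mul_le_mul_of_nonneg_left (by linarith [ht.2]) hC0)
    nlinarith [norm_nonneg u]
  have h1 : χ (y t) = 1 := χ.one_of_mem_closedBall (by simpa using hyR)
  simpa [h1] using hy t ht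

/-- A function known to satisfy `F s' = F s + G s' (w s') + O(‖w s'‖²)` near `s`, where `w`
vanishes at `s`, is differentiated as the product `G · w`. -/
theorem hasDerivWithinAt_of_quadratic_remainder {F w : ℝ → E} {G : ℝ → E →L[ℝ] E} {S : Set ℝ}
    {s C : ℝ} {q : E} (hw : HasDerivWithinAt w q S s) (hw0 : w s = 0)
    (hG : ContinuousWithinAt G S s)
    (hF : ∀ᶠ r in 𝓝[S] s, ‖F r - F s - G r (w r)‖ ≤ C * ‖w r‖ ^ 2) :
    HasDerivWithinAt F (G s q) S s := by
  have hle : 𝓝[S \ {s}] s ≤ 𝓝[S] s := nhdsWithin_mono s sdiff_subset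
  have hslope := hasDerivWithinAt_iff_tendsto_slope.1 hw
  have hw' : Tendsto w (𝓝[S \ {s}] s) (𝓝 0) := by
    rw [← hw0]; exact (hw.continuousWithinAt.tendsto).mono_left hle
  have hmain : Tendsto (fun r => G r (slope w s r)) (𝓝[S \ {s}] s) (𝓝 (G s q)) :=
    (isBoundedBilinearMap_apply.continuous.tendsto (G s, q)).comp
      ((hG.tendsto.mono_left hle).prodMk_nhds hslope)
  have hrem : Tendsto (fun r => slope F s r - G r (slope w s r)) (𝓝[S \ {s}] s) (𝓝 0) := by
    have hz : Tendsto (fun r => C * ‖w r‖ * ‖slope w s r‖) (𝓝[S \ {s}] s) (𝓝 0) := by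
      simpa using (hw'.norm.const_mul C).mul hslope.norm
    refine squeeze_zero_norm' ?_ hz
    filter_upwards [hF.filter_mono hle, self_mem_nhdsWithin] with r hr hrs
    have hne : r - s ≠ 0 := sub_ne_zero.2 hrs.2
    have heq : slope F s r - G r (slope w s r) = (r - s)⁻¹ • (F r - F s - G r (w r)) := by
      simp [slope_def_module, hw0, smul_sub]
    rw [heq, norm_smul, slope_def_module, hw0, sub_zero, norm_smul]
    calc ‖(r - s)⁻¹‖ * ‖F r - F s - G r (w r)‖ ≤ ‖(r - s)⁻¹‖ * (C * ‖w r‖ ^ 2) := by gcongr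
      _ = C * ‖w r‖ * (‖(r - s)⁻¹‖ * ‖w r‖) := by ring
  rw [hasDerivWithinAt_iff_tendsto_slope]
  simpa using hrem.add hmain

/-- Taylor's inequality of order one for a map whose derivative is globally Lipschitz. -/
theorem norm_sub_sub_fderiv_le_of_lipschitzWith_fderiv {f : E → E} (hf : Differentiable ℝ f)
    {K : ℝ≥0} (hK : LipschitzWith K (fderiv ℝ f)) (x y : E) :
    ‖f y - f x - fderiv ℝ f x (y - x)‖ ≤ K * ‖y - x‖ ^ 2 := by
  have := (convex_segment (𝕜 := ℝ) x y).norm_image_sub_le_of_norm_fderiv_le' (f := f)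
    (φ := fderiv ℝ f x) (C := K * ‖y - x‖) (fun z _ => hf z) (fun z hz => by
      refine (hK.norm_sub_le z x).trans ?_
      gcongr
      simpa using norm_sub_le_of_mem_segment hz) (left_mem_segment ℝ x y) (right_mem_segment ℝ x y)
  calc _ ≤ K * ‖y - x‖ * ‖y - x‖ := this
    _ = _ := by ring

end OrdinaryDifferentialEquations

/-! ### The solution map and the fundamental matrix -/

section Flow

open Filter Topology NNReal

variable {d : ℕ} {h : Vec d → Vec d} {s t T : ℝ} {u : Vec d}

theorem IsODESolution.mono {y : ℝ → Vec d} (hy : IsODESolution h s T u y) {T' : ℝ}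
    (hT' : T' ≤ T) : IsODESolution h s T' u y :=
  ⟨hy.1, fun t ht => (hy.2 t ⟨ht.1, ht.2.trans hT'⟩).mono (Icc_subset_Icc_right hT')⟩

theorem IsODESolution.continuousOn {y : ℝ → Vec d} (hy : IsODESolution h s T u y) :
    ContinuousOn y (Icc s T) :=
  fun t ht => (hy.2 t ht).continuousWithinAt

theorem HasODESolution.mono (H : HasODESolution h s T u) {T' : ℝ} (hT' : T' ≤ T) :
    HasODESolution h s T' u :=
  H.imp fun _ hy => hy.mono hT'

/-- Uniqueness: two solutions stay in a common ball, where the field is Lipschitz. -/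
theorem IsODESolution.eqOn (hh : ContDiff ℝ 1 h) {y z : ℝ → Vec d}
    (hy : IsODESolution h s T u y) (hz : IsODESolution h s T u z) : EqOn y z (Icc s T) := by
  obtain ⟨R₁, hR₁⟩ := isCompact_Icc.exists_bound_of_continuousOn hy.continuousOn
  obtain ⟨R₂, hR₂⟩ := isCompact_Icc.exists_bound_of_continuousOn hz.continuousOn
  obtain ⟨K, hK⟩ := hh.contDiffOn.exists_lipschitzOnWith one_ne_zero
    (convex_closedBall (0 : Vec d) (max R₁ R₂)) (isCompact_closedBall _ _)
  refine ODE_solution_unique_of_mem_Icc_right (v := fun _ => h)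
    (s := fun _ => Metric.closedBall (0 : Vec d) (max R₁ R₂)) (K := K)
    (fun _ _ => hK) hy.continuousOn
    (fun t ht => (hy.2 t (Ico_subset_Icc_self ht)).Ici_of_Icc ht)
    (fun t ht => ?_) hz.continuousOn
    (fun t ht => (hz.2 t (Ico_subset_Icc_self ht)).Ici_of_Icc ht)
    (fun t ht => ?_) (hy.1.trans hz.1.symm)
  · simpa using Or.inl (hR₁ t (Ico_subset_Icc_self ht))
  · simpa using Or.inr (hR₂ t (Ico_subset_Icc_self ht))

theorem IsODESolution.odeSol_eq (hh : ContDiff ℝ 1 h) {y : ℝ → Vec d}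
    (hy : IsODESolution h s T u y) (ht : t ∈ Icc s T) : odeSol h t s u = y t := by
  have H : HasODESolution h s t u := ⟨y, hy.mono ht.2⟩
  rw [odeSol, dif_pos H]
  exact (Classical.choose_spec H).eqOn hh (hy.mono ht.2) (right_mem_Icc.2 ht.1)

theorem HasODESolution.isODESolution_odeSol (hh : ContDiff ℝ 1 h) (hsT : s ≤ T)
    (H : HasODESolution h s T u) : IsODESolution h s T u (fun t => odeSol h t s u) := by
  obtain ⟨y, hy⟩ := H
  have heq : ∀ t ∈ Icc s T, odeSol h t s u = y t := fun t ht => hy.odeSol_eq hh ht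
  refine ⟨(heq s (left_mem_Icc.2 hsT)).trans hy.1, fun t ht => ?_⟩
  have := hy.2 t ht
  rw [← heq t ht] at this
  exact this.congr heq (heq t ht)

theorem hasODESolution_self (h : Vec d → Vec d) (s : ℝ) (u : Vec d) :
    HasODESolution h s s u :=
  ⟨fun _ => u, rfl, fun t ht => by
    obtain rfl : t = s := le_antisymm ht.2 ht.1
    rw [Icc_self]
    exact HasFDerivWithinAt.of_subsingleton subsingleton_singleton⟩

theorem odeSol_self (hh : ContDiff ℝ 1 h) : odeSol h s s u = u :=
  ((hasODESolution_self h s u).isODESolution_odeSol hh le_rfl).1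

theorem IsODESolution.comp_sub_const {y : ℝ → Vec d} (hy : IsODESolution h s T u y) (c : ℝ) :
    IsODESolution h (s + c) (T + c) u (fun t => y (t - c)) :=
  ⟨by simpa using hy.1, fun t ht => HasDerivWithinAt.comp_sub_const_Icc
    (hy.2 (t - c) ⟨by linarith [ht.1], by linarith [ht.2]⟩)⟩

theorem hasODESolution_iff_zero_sub :
    HasODESolution h s T u ↔ HasODESolution h 0 (T - s) u := by
  refine ⟨fun ⟨y, hy⟩ => ⟨fun t => y (t - -s), ?_⟩, fun ⟨y, hy⟩ => ⟨fun t => y (t - s), ?_⟩⟩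
  · simpa only [add_neg_cancel, ← sub_eq_add_neg] using hy.comp_sub_const (-s)
  · simpa only [zero_add, sub_add_cancel] using hy.comp_sub_const s

theorem odeSol_eq_zero_sub (hh : ContDiff ℝ 1 h) (hst : s ≤ t) (H : HasODESolution h s t u) :
    odeSol h t s u = odeSol h (t - s) 0 u := by
  have h0 := (hasODESolution_iff_zero_sub.1 H).isODESolution_odeSol hh (sub_nonneg.2 hst)
  have h1 := h0.comp_sub_const s
  rw [zero_add, sub_add_cancel] at h1
  exact h1.odeSol_eq hh (right_mem_Icc.2 hst)

/-- The semigroup property: a solution may be restarted at an intermediate time `e`. -/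
theorem HasODESolution.restart (hh : ContDiff ℝ 1 h) (H : HasODESolution h s T u) {e : ℝ}
    (he : e ∈ Icc s T) :
    HasODESolution h e T (odeSol h e s u) ∧
      odeSol h T e (odeSol h e s u) = odeSol h T s u := by
  have hy := H.isODESolution_odeSol hh (he.1.trans he.2)
  have hz : IsODESolution h e T (odeSol h e s u) (fun t => odeSol h t s u) :=
    ⟨rfl, fun t ht => (hy.2 t ⟨he.1.trans ht.1, ht.2⟩).mono (Icc_subset_Icc_left he.1)⟩
  exact ⟨⟨_, hz⟩, hz.odeSol_eq hh (right_mem_Icc.2 he.2)⟩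

theorem continuousOn_fderiv_odeSol (hh : ContDiff ℝ 1 h) (hsT : s ≤ T)
    (H : HasODESolution h s T u) :
    ContinuousOn (fun t => fderiv ℝ h (odeSol h t s u)) (Icc s T) :=
  (hh.continuous_fderiv one_ne_zero).comp_continuousOn
    (H.isODESolution_odeSol hh hsT).continuousOn

theorem IsFundamentalSolution.mono {Y : ℝ → Vec d →L[ℝ] Vec d}
    (hY : IsFundamentalSolution h s T u Y) {T' : ℝ} (hT' : T' ≤ T) :
    IsFundamentalSolution h s T' u Y :=
  ⟨hY.1, fun t ht => (hY.2 t ⟨ht.1, ht.2.trans hT'⟩).mono (Icc_subset_Icc_right hT')⟩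

theorem IsFundamentalSolution.continuousOn {Y : ℝ → Vec d →L[ℝ] Vec d}
    (hY : IsFundamentalSolution h s T u Y) : ContinuousOn Y (Icc s T) :=
  fun t ht => (hY.2 t ht).continuousWithinAt

theorem HasODESolution.exists_isFundamentalSolution (hh : ContDiff ℝ 1 h) (hsT : s ≤ T)
    (H : HasODESolution h s T u) : ∃ Y, IsFundamentalSolution h s T u Y := by
  obtain ⟨Y, hY0, hY⟩ := exists_hasDerivWithinAt_linear
    (A := fun t => ContinuousLinearMap.compL ℝ (Vec d) (Vec d) (Vec d)
      (fderiv ℝ h (odeSol h t s u))) hsT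
    ((ContinuousLinearMap.continuous _).comp_continuousOn (continuousOn_fderiv_odeSol hh hsT H))
    (ContinuousLinearMap.id ℝ (Vec d))
  exact ⟨Y, hY0, fun t ht => by simpa using hY t ht⟩

theorem IsFundamentalSolution.eqOn (hh : ContDiff ℝ 1 h) (hsT : s ≤ T)
    (H : HasODESolution h s T u) {Y Z : ℝ → Vec d →L[ℝ] Vec d}
    (hY : IsFundamentalSolution h s T u Y) (hZ : IsFundamentalSolution h s T u Z) :
    EqOn Y Z (Icc s T) := by
  obtain ⟨C, hC⟩ := isCompact_Icc.exists_bound_of_continuousOn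
    (continuousOn_fderiv_odeSol hh hsT H)
  have hbd := norm_le_gronwallBound_of_hasDerivWithinAt_Icc (f := fun t => Y t - Z t) (δ := 0)
    (K := C) (ε := 0) (fun t ht => (hY.2 t ht).sub (hZ.2 t ht)) (by simp [hY.1, hZ.1])
    (fun t ht => by
      rw [← ContinuousLinearMap.comp_sub, add_zero]
      refine (ContinuousLinearMap.opNorm_comp_le _ _).trans ?_
      gcongr
      exact hC t ht)
  intro t ht
  have := hbd t ht
  rw [gronwallBound_ε0_δ0] at this
  exact sub_eq_zero.1 (norm_le_zero_iff.1 this)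

theorem IsFundamentalSolution.fundMatrix_eq (hh : ContDiff ℝ 1 h)
    (H : HasODESolution h s T u) {Y : ℝ → Vec d →L[ℝ] Vec d}
    (hY : IsFundamentalSolution h s T u Y) (ht : t ∈ Icc s T) : fundMatrix h t s u = Y t := by
  have hex : ∃ Y, IsFundamentalSolution h s t u Y := ⟨Y, hY.mono ht.2⟩
  rw [fundMatrix, dif_pos hex]
  exact (Classical.choose_spec hex).eqOn hh ht.1 (H.mono ht.2) (hY.mono ht.2)
    (right_mem_Icc.2 ht.1)

theorem HasODESolution.isFundamentalSolution_fundMatrix (hh : ContDiff ℝ 1 h) (hsT : s ≤ T)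
    (H : HasODESolution h s T u) :
    IsFundamentalSolution h s T u (fun t => fundMatrix h t s u) := by
  obtain ⟨Y, hY⟩ := H.exists_isFundamentalSolution hh hsT
  have heq : ∀ t ∈ Icc s T, fundMatrix h t s u = Y t := fun t ht => hY.fundMatrix_eq hh H ht
  refine ⟨(heq s (left_mem_Icc.2 hsT)).trans hY.1, fun t ht => ?_⟩
  have := hY.2 t ht
  rw [← heq t ht] at this
  exact this.congr heq (heq t ht)

theorem fundMatrix_self (hh : ContDiff ℝ 1 h) :
    fundMatrix h s s u = ContinuousLinearMap.id ℝ (Vec d) :=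
  ((hasODESolution_self h s u).isFundamentalSolution_fundMatrix hh le_rfl).1

theorem fundMatrix_eq_zero_sub (hh : ContDiff ℝ 1 h) (hst : s ≤ t)
    (H : HasODESolution h s t u) : fundMatrix h t s u = fundMatrix h (t - s) 0 u := by
  have h0 := (hasODESolution_iff_zero_sub.1 H).isFundamentalSolution_fundMatrix hh
    (sub_nonneg.2 hst)
  have h1 : IsFundamentalSolution h s t u (fun τ => fundMatrix h (τ - s) 0 u) := by
    refine ⟨by simpa using h0.1, fun τ hτ => ?_⟩
    have := HasDerivWithinAt.comp_sub_const_Icc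
      (h0.2 (τ - s) ⟨by linarith [hτ.1], by linarith [hτ.2]⟩)
    rw [zero_add, sub_add_cancel] at this
    rwa [odeSol_eq_zero_sub hh hτ.1 (H.mono hτ.2)]
  exact h1.fundMatrix_eq hh H (right_mem_Icc.2 hst)

end Flow

/-! ### Dependence on the starting point for a compactly supported field -/

section CompactSupport

open Filter Topology NNReal

variable {d : ℕ} {g : Vec d → Vec d} {s t T : ℝ} {u v : Vec d}

theorem HasCompactSupport.hasODESolution (hgs : HasCompactSupport g) (hg : ContDiff ℝ 1 g)
    (hsT : s ≤ T) : HasODESolution g s T u := by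
  obtain ⟨K, hK⟩ := hg.lipschitzWith_of_hasCompactSupport hgs one_ne_zero
  obtain ⟨B, hB⟩ := hg.continuous.norm.bddAbove_range_of_hasCompactSupport hgs.norm
  have hB0 : 0 ≤ B := (norm_nonneg (g 0)).trans (hB ⟨0, rfl⟩)
  exact exists_hasDerivWithinAt_of_bounded_lipschitz (f := fun _ => g) (L := ⟨B, hB0⟩) hsT
    (fun _ _ => hK) (fun _ => continuousOn_const) (fun _ _ x => hB ⟨x, rfl⟩) u

theorem norm_odeSol_sub_le (hgs : HasCompactSupport g) (hg : ContDiff ℝ 1 g) {K : ℝ≥0}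
    (hK : LipschitzWith K g) (ht : 0 ≤ t) :
    ‖odeSol g t 0 v - odeSol g t 0 u‖ ≤ Real.exp (K * t) * ‖v - u‖ := by
  have hu := (hgs.hasODESolution hg ht (u := u)).isODESolution_odeSol hg ht
  have hv := (hgs.hasODESolution hg ht (u := v)).isODESolution_odeSol hg ht
  have := norm_le_gronwallBound_of_hasDerivWithinAt_Icc (δ := ‖v - u‖) (K := K) (ε := 0)
    (fun t ht => (hv.2 t ht).sub (hu.2 t ht)) (by simp [odeSol_self hg])
    (fun t _ => by simpa using hK.norm_sub_le _ _) t (right_mem_Icc.2 ht)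
  rwa [gronwallBound_ε0, sub_zero, mul_comm] at this

theorem norm_fundMatrix_le (hgs : HasCompactSupport g) (hg : ContDiff ℝ 1 g) {K : ℝ≥0}
    (hK : LipschitzWith K g) (ht : 0 ≤ t) :
    ‖fundMatrix g t 0 u‖ ≤ Real.exp (K * t) := by
  have hY := (hgs.hasODESolution hg ht (u := u)).isFundamentalSolution_fundMatrix hg ht
  have := norm_le_gronwallBound_of_hasDerivWithinAt_Icc (δ := 1) (K := K) (ε := 0) hY.2
    (by rw [fundMatrix_self hg]; exact ContinuousLinearMap.norm_id_le) (fun τ _ => by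
      rw [add_zero]
      refine (ContinuousLinearMap.opNorm_comp_le _ _).trans ?_
      gcongr
      exact norm_fderiv_le_of_lipschitz ℝ hK) t (right_mem_Icc.2 ht)
  rwa [gronwallBound_ε0, sub_zero, one_mul] at this

/-- For a compactly supported `C²` field the solution and the fundamental matrix are Lipschitz in
the starting point, and the fundamental matrix is the derivative of the solution in the starting
point with a quadratic remainder, uniformly on bounded time intervals. All three bounds are
instances of Grönwall's inequality. -/
theorem exists_flow_estimates (hgs : HasCompactSupport g) (hg : ContDiff ℝ 2 g) (T : ℝ) :
    ∃ C : ℝ≥0, ∀ t ∈ Icc 0 T, ∀ u v : Vec d,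
      ‖odeSol g t 0 v - odeSol g t 0 u‖ ≤ C * ‖v - u‖ ∧
      ‖fundMatrix g t 0 v - fundMatrix g t 0 u‖ ≤ C * ‖v - u‖ ∧
      ‖odeSol g t 0 v - odeSol g t 0 u - fundMatrix g t 0 u (v - u)‖ ≤ C * ‖v - u‖ ^ 2 := by
  have hg1 : ContDiff ℝ 1 g := hg.of_le one_le_two
  obtain ⟨K, hK⟩ := hg1.lipschitzWith_of_hasCompactSupport hgs one_ne_zero
  have hdg : ContDiff ℝ 1 (fderiv ℝ g) := hg.fderiv_right (by norm_num)
  obtain ⟨K', hK'⟩ := hdg.lipschitzWith_of_hasCompactSupport (hgs.fderiv ℝ) one_ne_zero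
  set c := Real.exp (K * T) with hc
  have hc0 : 0 < c := Real.exp_pos _
  set B := K' * c ^ 2 * gronwallBound 0 K 1 T with hB
  have hexp : ∀ t ∈ Icc 0 T, Real.exp (K * t) ≤ c := fun t ht =>
    Real.exp_le_exp.2 (mul_le_mul_of_nonneg_left ht.2 K.2)
  have hmono : ∀ t ∈ Icc 0 T, ∀ ε : ℝ, 0 ≤ ε →
      gronwallBound 0 K ε (t - 0) ≤ ε * gronwallBound 0 K 1 T := by
    intro t ht ε hε
    rw [gronwallBound_zero_left_eq_mul, sub_zero]
    exact mul_le_mul_of_nonneg_left (gronwallBound_mono le_rfl zero_le_one K.2 ht.2) hε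
  refine ⟨(c + max B 0).toNNReal, fun t ht u v => ?_⟩
  rw [Real.coe_toNNReal _ (by positivity)]
  have ht0 : 0 ≤ t := ht.1
  have hsub : ∀ τ ∈ Icc 0 t, τ ∈ Icc 0 T := fun τ hτ => ⟨hτ.1, hτ.2.trans ht.2⟩
  have hCc : c ≤ c + max B 0 := by simp
  have hCB : B ≤ c + max B 0 := by linarith [le_max_left B 0]
  have hdist : ∀ τ ∈ Icc 0 t, ‖odeSol g τ 0 v - odeSol g τ 0 u‖ ≤ c * ‖v - u‖ := fun τ hτ =>
    (norm_odeSol_sub_le hgs hg1 hK hτ.1).trans (by gcongr; exact hexp τ (hsub τ hτ))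
  have hYle : ∀ w, ∀ τ ∈ Icc 0 t, ‖fundMatrix g τ 0 w‖ ≤ c := fun w τ hτ =>
    (norm_fundMatrix_le hgs hg1 hK hτ.1).trans (hexp τ (hsub τ hτ))
  have hu := (hgs.hasODESolution hg1 ht0 (u := u)).isODESolution_odeSol hg1 ht0
  have hv := (hgs.hasODESolution hg1 ht0 (u := v)).isODESolution_odeSol hg1 ht0
  have hYu := (hgs.hasODESolution hg1 ht0 (u := u)).isFundamentalSolution_fundMatrix hg1 ht0
  have hYv := (hgs.hasODESolution hg1 ht0 (u := v)).isFundamentalSolution_fundMatrix hg1 ht0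
  have hA : ∀ w, ‖fderiv ℝ g w‖ ≤ K := fun w => norm_fderiv_le_of_lipschitz ℝ hK
  refine ⟨(hdist t (right_mem_Icc.2 ht0)).trans (by gcongr), ?_, ?_⟩
  · -- `Yᵥ' - Yᵤ' = A_v (Yᵥ - Yᵤ) + (A_v - A_u) Yᵤ`
    have := norm_le_gronwallBound_of_hasDerivWithinAt_Icc
      (f := fun τ => fundMatrix g τ 0 v - fundMatrix g τ 0 u) (δ := 0) (K := K)
      (ε := K' * (c * ‖v - u‖) * c)
      (fun τ hτ => (hYv.2 τ hτ).sub (hYu.2 τ hτ)) (by simp [fundMatrix_self hg1]) (fun τ hτ => by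
        set Av := fderiv ℝ g (odeSol g τ 0 v)
        set Au := fderiv ℝ g (odeSol g τ 0 u)
        have hsplit : Av.comp (fundMatrix g τ 0 v) - Au.comp (fundMatrix g τ 0 u) =
            Av.comp (fundMatrix g τ 0 v - fundMatrix g τ 0 u) +
              (Av - Au).comp (fundMatrix g τ 0 u) := by
          simp [ContinuousLinearMap.comp_sub, ContinuousLinearMap.sub_comp]
        rw [hsplit]
        refine (norm_add_le _ _).trans (add_le_add ?_ ?_)
        · refine (ContinuousLinearMap.opNorm_comp_le _ _).trans ?_
          gcongr
          exact hA _
        · refine (ContinuousLinearMap.opNorm_comp_le _ _).trans ?_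
          gcongr
          · exact (hK'.norm_sub_le _ _).trans (by gcongr; exact hdist τ hτ)
          · exact hYle u τ hτ) t (right_mem_Icc.2 ht0)
    calc _ ≤ _ := this
      _ ≤ K' * (c * ‖v - u‖) * c * gronwallBound 0 K 1 T := hmono t ht _ (by positivity)
      _ = B * ‖v - u‖ := by rw [hB]; ring
      _ ≤ _ := by gcongr
  · -- the remainder solves the linearised equation up to a quadratic error
    have := norm_le_gronwallBound_of_hasDerivWithinAt_Icc
      (f := fun τ => odeSol g τ 0 v - odeSol g τ 0 u - fundMatrix g τ 0 u (v - u))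
      (δ := 0) (K := K) (ε := K' * (c * ‖v - u‖) ^ 2)
      (fun τ hτ => ((hv.2 τ hτ).sub (hu.2 τ hτ)).sub
        ((hYu.2 τ hτ).clm_apply (hasDerivWithinAt_const τ _ (v - u))))
      (by simp [odeSol_self hg1, fundMatrix_self hg1]) (fun τ hτ => by
        set xv := odeSol g τ 0 v
        set xu := odeSol g τ 0 u
        have hsplit : g xv - g xu - (((fderiv ℝ g xu).comp (fundMatrix g τ 0 u)) (v - u) +
            fundMatrix g τ 0 u 0) =
            fderiv ℝ g xu (xv - xu - fundMatrix g τ 0 u (v - u)) +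
              (g xv - g xu - fderiv ℝ g xu (xv - xu)) := by
          simp only [map_sub, map_zero, ContinuousLinearMap.comp_apply]; abel
        refine (congrArg norm hsplit).le.trans ((norm_add_le _ _).trans (add_le_add ?_ ?_))
        · exact (ContinuousLinearMap.le_opNorm _ _).trans (by gcongr; exact hA _)
        · refine (norm_sub_sub_fderiv_le_of_lipschitzWith_fderiv
            (hg1.differentiable one_ne_zero) hK' xu xv).trans ?_
          gcongr
          exact hdist τ hτ) t (right_mem_Icc.2 ht0)
    calc _ ≤ _ := this
      _ ≤ K' * (c * ‖v - u‖) ^ 2 * gronwallBound 0 K 1 T := hmono t ht _ (by positivity)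
      _ = B * ‖v - u‖ ^ 2 := by rw [hB]; ring
      _ ≤ _ := by gcongr

end CompactSupport

/-! ### The local flow of a `C²` field -/

section LocalFlow

open Filter Topology NNReal

variable {d : ℕ} {g h : Vec d → Vec d} {s t T : ℝ} {u u₀ : Vec d}

/-- As long as its trajectory stays in an open set where `g = h`, a starting point does not
distinguish the two fields. -/
theorem HasODESolution.congr_of_eqOn (hg : ContDiff ℝ 1 g) (hh : ContDiff ℝ 1 h)
    {U : Set (Vec d)} (hU : IsOpen U) (hgh : EqOn g h U) (hT : 0 ≤ T)
    (H : HasODESolution g 0 T u) (hmem : ∀ t ∈ Icc 0 T, odeSol g t 0 u ∈ U) :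
    HasODESolution h 0 T u ∧ ∀ t ∈ Icc 0 T,
      odeSol h t 0 u = odeSol g t 0 u ∧ fundMatrix h t 0 u = fundMatrix g t 0 u := by
  have hy := H.isODESolution_odeSol hg hT
  have hyh : IsODESolution h 0 T u (fun t => odeSol g t 0 u) :=
    ⟨hy.1, fun t ht => by rw [← hgh (hmem t ht)]; exact hy.2 t ht⟩
  have hsol : ∀ t ∈ Icc 0 T, odeSol h t 0 u = odeSol g t 0 u := fun t ht => hyh.odeSol_eq hh ht
  have hY := H.isFundamentalSolution_fundMatrix hg hT
  have hYh : IsFundamentalSolution h 0 T u (fun t => fundMatrix g t 0 u) :=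
    ⟨hY.1, fun t ht => by
      have hfd : fderiv ℝ g (odeSol g t 0 u) = fderiv ℝ h (odeSol g t 0 u) :=
        (hgh.eventuallyEq_of_mem (hU.mem_nhds (hmem t ht))).fderiv_eq
      rw [hsol t ht, ← hfd]
      exact hY.2 t ht⟩
  exact ⟨⟨_, hyh⟩, fun t ht => ⟨hsol t ht, hYh.fundMatrix_eq hh ⟨_, hyh⟩ ht⟩⟩

/-- Near a starting point whose solution exists up to time `T`, solutions exist a little longer,
depend continuously on time and starting point together with the fundamental matrix, and the
latter is the derivative in the starting point with a quadratic remainder.  The field is cut off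
outside a ball that contains a neighbourhood of the trajectory. -/
theorem HasODESolution.exists_local_flow (hh : ContDiff ℝ 2 h) (hT : 0 ≤ T)
    (H : HasODESolution h 0 T u₀) :
    ∃ ε > 0, ∃ C : ℝ≥0,
      (∀ u ∈ Metric.ball u₀ ε, HasODESolution h 0 (T + ε) u) ∧
      (∀ t ∈ Icc 0 (T + ε), ∀ u ∈ Metric.ball u₀ ε, ∀ v ∈ Metric.ball u₀ ε,
        ‖odeSol h t 0 v - odeSol h t 0 u - fundMatrix h t 0 u (v - u)‖ ≤ C * ‖v - u‖ ^ 2) ∧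
      ContinuousOn (fun p : ℝ × Vec d => odeSol h p.1 0 p.2)
        (Icc 0 (T + ε) ×ˢ Metric.ball u₀ ε) ∧
      ContinuousOn (fun p : ℝ × Vec d => fundMatrix h p.1 0 p.2)
        (Icc 0 (T + ε) ×ˢ Metric.ball u₀ ε) := by
  have hh1 : ContDiff ℝ 1 h := hh.of_le one_le_two
  have hy := H.isODESolution_odeSol hh1 hT
  obtain ⟨R, hR⟩ := isCompact_Icc.exists_bound_of_continuousOn hy.continuousOn
  have hR0 : 0 ≤ R := (norm_nonneg _).trans (hR 0 (left_mem_Icc.2 hT))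
  let χ : ContDiffBump (0 : Vec d) := ⟨R + 2, R + 3, by linarith, by linarith⟩
  set g : Vec d → Vec d := fun z => χ z • h z with hg_def
  have hgs : HasCompactSupport g := χ.hasCompactSupport.smul_right (f' := h)
  have hg : ContDiff ℝ 2 g := χ.contDiff.smul hh
  have hg1 : ContDiff ℝ 1 g := hg.of_le one_le_two
  have hgh : EqOn g h (Metric.ball 0 (R + 2)) := fun z hz => by
    rw [hg_def]
    simp [χ.one_of_mem_closedBall (Metric.ball_subset_closedBall hz)]
  obtain ⟨C, hC⟩ := exists_flow_estimates hgs hg (T + 1)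
  -- the trajectory of `u₀` under `g` stays in the ball a little beyond time `T`
  have hz := (hgs.hasODESolution hg1 (by linarith : (0 : ℝ) ≤ T + 1)
    (u := u₀)).isODESolution_odeSol hg1 (by linarith)
  have hzy : ∀ t ∈ Icc 0 T, odeSol g t 0 u₀ = odeSol h t 0 u₀ := fun t ht =>
    ((H.congr_of_eqOn hh1 hg1 Metric.isOpen_ball hgh.symm hT fun t ht => by
      rw [mem_ball_zero_iff]; linarith [hR t ht]).2 t ht).1
  obtain ⟨δ, hδ, hδz⟩ : ∃ δ > 0, ∀ t ∈ Icc 0 (T + 1), dist t T < δ →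
      ‖odeSol g t 0 u₀‖ < R + 1 := by
    have hev : ∀ᶠ t in 𝓝[Icc 0 (T + 1)] T, ‖odeSol g t 0 u₀‖ < R + 1 := by
      refine (hz.continuousOn T ⟨hT, by linarith⟩).norm.eventually_lt continuousWithinAt_const ?_
      have hRT := hR T (right_mem_Icc.2 hT)
      rw [← hzy T (right_mem_Icc.2 hT)] at hRT
      exact lt_of_le_of_lt hRT (lt_add_one R)
    obtain ⟨δ, hδ, hsub⟩ := Metric.mem_nhdsWithin_iff.1 hev
    exact ⟨δ, hδ, fun t ht htd => hsub ⟨htd, ht⟩⟩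
  -- `ε < δ` and `ε ≤ 1` keep the time range controlled; `C ε ≤ 1` keeps the trajectories of
  -- nearby points within distance `1` of that of `u₀`
  set ε := min (min (δ / 2) 1) (1 / (C + 1)) with hε_def
  have hC1 : (0 : ℝ) < C + 1 := by positivity
  have hε : 0 < ε := by positivity
  have hε1 : ε ≤ 1 := (min_le_left _ _).trans (min_le_right _ _)
  have hεδ : ε < δ := lt_of_le_of_lt ((min_le_left _ _).trans (min_le_left _ _)) (by linarith)
  have hεC : C * ε ≤ 1 := by
    have : ε ≤ 1 / (C + 1) := min_le_right _ _
    rw [le_div_iff₀ hC1] at this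
    nlinarith
  have hT1 : ∀ t ∈ Icc 0 (T + ε), t ∈ Icc 0 (T + 1) := fun t ht =>
    ⟨ht.1, ht.2.trans (by linarith)⟩
  have hTε : 0 ≤ T + ε := by linarith
  have hzR : ∀ t ∈ Icc 0 (T + ε), ‖odeSol g t 0 u₀‖ < R + 1 := by
    intro t ht
    rcases le_or_gt t T with htT | htT
    · rw [hzy t ⟨ht.1, htT⟩]; linarith [hR t ⟨ht.1, htT⟩]
    · refine hδz t (hT1 t ht) ?_
      rw [Real.dist_eq, abs_of_pos (by linarith)]
      linarith [ht.2]
  have hkey : ∀ u ∈ Metric.ball u₀ ε, HasODESolution h 0 (T + ε) u ∧ ∀ t ∈ Icc 0 (T + ε),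
      odeSol h t 0 u = odeSol g t 0 u ∧ fundMatrix h t 0 u = fundMatrix g t 0 u := by
    intro u hu
    refine (hgs.hasODESolution hg1 hTε).congr_of_eqOn hg1 hh1 Metric.isOpen_ball hgh hTε ?_
    intro t ht
    rw [mem_ball_zero_iff]
    rw [mem_ball_iff_norm] at hu
    have h1 := (hC t (hT1 t ht) u₀ u).1
    have h2 := norm_sub_norm_le (odeSol g t 0 u) (odeSol g t 0 u₀)
    have h3 : C * ‖u - u₀‖ ≤ C * ε := by gcongr
    linarith [hzR t ht]
  refine ⟨ε, hε, C, fun u hu => (hkey u hu).1, fun t ht u hu v hv => ?_, ?_, ?_⟩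
  · rw [((hkey u hu).2 t ht).1, ((hkey v hv).2 t ht).1, ((hkey u hu).2 t ht).2]
    exact (hC t (hT1 t ht) u v).2.2
  · have hcont : ContinuousOn (fun p : ℝ × Vec d => odeSol g p.1 0 p.2)
        (Icc 0 (T + ε) ×ˢ Metric.ball u₀ ε) :=
      continuousOn_prod_of_continuousOn_lipschitzOnWith' _ C
        (fun t ht => LipschitzOnWith.of_dist_le_mul fun v _ u _ => by
          simpa only [dist_eq_norm] using (hC t (hT1 t ht) u v).1)
        (fun u _ => ((hgs.hasODESolution hg1 hTε).isODESolution_odeSol hg1 hTε).continuousOn)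
    exact hcont.congr fun p hp => ((hkey p.2 hp.2).2 p.1 hp.1).1
  · have hcont : ContinuousOn (fun p : ℝ × Vec d => fundMatrix g p.1 0 p.2)
        (Icc 0 (T + ε) ×ˢ Metric.ball u₀ ε) :=
      continuousOn_prod_of_continuousOn_lipschitzOnWith' _ C
        (fun t ht => LipschitzOnWith.of_dist_le_mul fun v _ u _ => by
          simpa only [dist_eq_norm] using (hC t (hT1 t ht) u v).2.1)
        (fun u _ => ((hgs.hasODESolution hg1 hTε).isFundamentalSolution_fundMatrix
          hg1 hTε).continuousOn)
    exact hcont.congr fun p hp => ((hkey p.2 hp.2).2 p.1 hp.1).2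

/-- The pairs `(t, u)` such that the solution started from `u` at time `0` exists up to
time `t ≥ 0`. -/
def flowDomain (h : Vec d → Vec d) : Set (ℝ × Vec d) :=
  {p | 0 ≤ p.1 ∧ HasODESolution h 0 p.1 p.2}

theorem Icc_prod_ball_mem_nhdsWithin_flowDomain {p : ℝ × Vec d} {ε : ℝ} (hε : 0 < ε) :
    Icc 0 (p.1 + ε) ×ˢ Metric.ball p.2 ε ∈ 𝓝[flowDomain h] p := by
  have : Iio (p.1 + ε) ×ˢ Metric.ball p.2 ε ∈ 𝓝 p :=
    prod_mem_nhds (Iio_mem_nhds (by linarith)) (Metric.ball_mem_nhds _ hε)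
  filter_upwards [mem_nhdsWithin_of_mem_nhds this, self_mem_nhdsWithin] with q hq hqD
  exact ⟨⟨hqD.1, hq.1.le⟩, hq.2⟩

theorem continuousOn_odeSol_flowDomain (hh : ContDiff ℝ 2 h) :
    ContinuousOn (fun p : ℝ × Vec d => odeSol h p.1 0 p.2) (flowDomain h) := by
  intro p hp
  obtain ⟨ε, hε, C, -, -, hc, -⟩ := hp.2.exists_local_flow hh hp.1
  exact (hc p ⟨⟨hp.1, by linarith⟩, Metric.mem_ball_self hε⟩).mono_of_mem_nhdsWithin
    (Icc_prod_ball_mem_nhdsWithin_flowDomain hε)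

theorem continuousOn_fundMatrix_flowDomain (hh : ContDiff ℝ 2 h) :
    ContinuousOn (fun p : ℝ × Vec d => fundMatrix h p.1 0 p.2) (flowDomain h) := by
  intro p hp
  obtain ⟨ε, hε, C, -, -, -, hc⟩ := hp.2.exists_local_flow hh hp.1
  exact (hc p ⟨⟨hp.1, by linarith⟩, Metric.mem_ball_self hε⟩).mono_of_mem_nhdsWithin
    (Icc_prod_ball_mem_nhdsWithin_flowDomain hε)

theorem isOpen_setOf_hasODESolution (hh : ContDiff ℝ 2 h) (hsT : s ≤ T) :
    IsOpen {u | HasODESolution h s T u} := by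
  rw [Metric.isOpen_iff]
  intro u hu
  obtain ⟨ε, hε, C, hsol, -⟩ :=
    (hasODESolution_iff_zero_sub.1 hu).exists_local_flow hh (sub_nonneg.2 hsT)
  exact ⟨ε, hε, fun v hv =>
    hasODESolution_iff_zero_sub.2 ((hsol v hv).mono (by linarith))⟩

end LocalFlow

/-! ### Alekseev's formula along a curve -/

section Alekseev

open Filter Topology NNReal

variable {d : ℕ} {h : Vec d → Vec d} {s τ b c : ℝ} {z z' : ℝ → Vec d} {q : Vec d}

/-- Moving the starting point along a curve `z` while running the flow to a fixed time `τ`: the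
result changes by the fundamental matrix applied to the defect `ż - h(z)`.  By the semigroup
property the flow from `z s` at time `s` may be restarted at a slightly later time `r`, from a point
at distance `O(r - s)` of `z r`; the quadratic remainder of the flow then gives the derivative. -/
theorem hasDerivWithinAt_odeSol_comp (hh : ContDiff ℝ 2 h) (hsτ : s < τ)
    (H : HasODESolution h s τ (z s)) (hz : HasDerivWithinAt z q (Ici s) s) :
    HasDerivWithinAt (fun r => odeSol h (τ - r) 0 (z r))
      (fundMatrix h (τ - s) 0 (z s) (q - h (z s))) (Ici s) s := by
  have hh1 : ContDiff ℝ 1 h := hh.of_le one_le_two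
  have hsol := H.isODESolution_odeSol hh1 hsτ.le
  have hmem : s ∈ Icc s τ := left_mem_Icc.2 hsτ.le
  have hnhds : Icc s τ ∈ 𝓝[≥] s := Icc_mem_nhdsGE hsτ
  have hself : odeSol h s s (z s) = z s := odeSol_self hh1
  have hderiv : HasDerivWithinAt (fun r => odeSol h r s (z s)) (h (z s)) (Ici s) s := by
    have := (hsol.2 s hmem).mono_of_mem_nhdsWithin hnhds
    simpa only [hself] using this
  obtain ⟨ε, hε, C, -, hquad, -⟩ :=
    (hasODESolution_iff_zero_sub.1 H).exists_local_flow hh (sub_nonneg.2 hsτ.le)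
  have hG : ContinuousWithinAt (fun r => fundMatrix h (τ - r) 0 (odeSol h r s (z s)))
      (Ici s) s := by
    have hpair : ContinuousOn (fun r => (τ - r, odeSol h r s (z s))) (Icc s τ) :=
      (continuousOn_const.sub continuousOn_id).prodMk hsol.continuousOn
    have hmaps : MapsTo (fun r => (τ - r, odeSol h r s (z s))) (Icc s τ) (flowDomain h) :=
      fun r hr => ⟨sub_nonneg.2 hr.2, hasODESolution_iff_zero_sub.1 (H.restart hh1 hr).1⟩
    exact ((continuousOn_fundMatrix_flowDomain hh).comp hpair hmaps s
      hmem).mono_of_mem_nhdsWithin hnhds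
  have key := hasDerivWithinAt_of_quadratic_remainder (C := C)
    (F := fun r => odeSol h (τ - r) 0 (z r)) (w := fun r => z r - odeSol h r s (z s))
    (G := fun r => fundMatrix h (τ - r) 0 (odeSol h r s (z s)))
    (hz.sub hderiv) (by simp [hself]) hG (by
      have hball : Metric.ball (z s) ε ∈ 𝓝 (z s) := Metric.ball_mem_nhds _ hε
      have h1 : ∀ᶠ r in 𝓝[≥] s, z r ∈ Metric.ball (z s) ε := hz.continuousWithinAt hball
      have h2 : ∀ᶠ r in 𝓝[≥] s, odeSol h r s (z s) ∈ Metric.ball (z s) ε :=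
        hderiv.continuousWithinAt (by rwa [hself])
      filter_upwards [h1, h2, hnhds] with r hr1 hr2 hr
      have hrestart := H.restart hh1 hr
      have hFs : odeSol h (τ - s) 0 (z s) = odeSol h (τ - r) 0 (odeSol h r s (z s)) := by
        rw [← odeSol_eq_zero_sub hh1 hsτ.le H, ← hrestart.2,
          odeSol_eq_zero_sub hh1 hr.2 hrestart.1]
      rw [hFs]
      exact hquad (τ - r) ⟨sub_nonneg.2 hr.2, by linarith [hr.1]⟩ _ hr2 _ hr1)
  simpa only [hself] using key

theorem continuousOn_fundMatrix_comp (hh : ContDiff ℝ 2 h) (hcτ : c ≤ τ)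
    (hz : ContinuousOn z (Icc b c)) (H : ∀ s ∈ Icc b c, HasODESolution h s τ (z s)) :
    ContinuousOn (fun s => fundMatrix h τ s (z s)) (Icc b c) := by
  have hcomp := (continuousOn_fundMatrix_flowDomain hh).comp
    ((continuousOn_const.sub continuousOn_id).prodMk hz : ContinuousOn (fun s => (τ - s, z s)) _)
    (fun s hs => ⟨sub_nonneg.2 (hs.2.trans hcτ), hasODESolution_iff_zero_sub.1 (H s hs)⟩)
  exact hcomp.congr fun s hs =>
    fundMatrix_eq_zero_sub (hh.of_le one_le_two) (hs.2.trans hcτ) (H s hs)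

/-- Alekseev's formula: the nonlinear variation of constants, obtained by integrating the
derivative of `s ↦ x(τ, s, z(s))`. -/
theorem integral_fundMatrix_eq_odeSol_sub (hh : ContDiff ℝ 2 h) (hbc : b ≤ c) (hcτ : c ≤ τ)
    (hz : ContinuousOn z (Icc b c))
    (hz' : ∀ s ∈ Ioo b c, HasDerivWithinAt z (z' s) (Ici s) s)
    (H : ∀ s ∈ Icc b c, HasODESolution h s τ (z s))
    (hint : IntervalIntegrable (fun s => fundMatrix h τ s (z s) (z' s - h (z s))) volume b c) :
    ∫ s in b..c, fundMatrix h τ s (z s) (z' s - h (z s)) =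
      odeSol h τ c (z c) - odeSol h τ b (z b) := by
  have hh1 : ContDiff ℝ 1 h := hh.of_le one_le_two
  have hF : ContinuousOn (fun s => odeSol h (τ - s) 0 (z s)) (Icc b c) :=
    (continuousOn_odeSol_flowDomain hh).comp
      ((continuousOn_const.sub continuousOn_id).prodMk hz :
        ContinuousOn (fun s => (τ - s, z s)) _)
      (fun s hs => ⟨sub_nonneg.2 (hs.2.trans hcτ), hasODESolution_iff_zero_sub.1 (H s hs)⟩)
  have hmain := intervalIntegral.integral_eq_sub_of_hasDeriv_right_of_le hbc hF (fun s hs => by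
    have hs' := H s (Ioo_subset_Icc_self hs)
    have hsτ : s < τ := hs.2.trans_le hcτ
    have := hasDerivWithinAt_odeSol_comp hh hsτ hs' (hz' s hs)
    rw [← fundMatrix_eq_zero_sub hh1 hsτ.le hs'] at this
    exact this.mono Ioi_subset_Ici_self) hint
  rw [hmain, odeSol_eq_zero_sub hh1 hcτ (H c (right_mem_Icc.2 hbc)),
    odeSol_eq_zero_sub hh1 (hbc.trans hcτ) (H b (left_mem_Icc.2 hbc))]

end Alekseev

/-! ### The interpolated path -/

section Interpolation

open Filter Topology

variable {d : ℕ} {a : ℕ → ℝ} {s : ℝ}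

theorem saTime_succ (a : ℕ → ℝ) (k : ℕ) : saTime a (k + 1) = saTime a k + a k :=
  Finset.sum_range_succ _ _

theorem saTime_strictMono (ha : ∀ k, 0 < a k) : StrictMono (saTime a) :=
  strictMono_nat_of_lt_succ fun k => by rw [saTime_succ]; linarith [ha k]

theorem saInterp_of_mem_Ico (ha : ∀ k, 0 < a k) (x : ℕ → Vec d) {k : ℕ}
    (hs : s ∈ Ico (saTime a k) (saTime a (k + 1))) :
    saInterp a x s = x k + ((s - saTime a k) / a k) • (x (k + 1) - x k) := by
  classical
  have H : ∃ n, s < saTime a (n + 1) := ⟨k, hs.2⟩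
  have hfind : Nat.find H = k := by
    rw [Nat.find_eq_iff]
    refine ⟨hs.2, fun j hj => not_lt.2 (le_trans ?_ hs.1)⟩
    exact (saTime_strictMono ha).monotone hj
  rw [saInterp, dif_pos H]
  simp only [hfind]

theorem saInterp_saTime (ha : ∀ k, 0 < a k) (x : ℕ → Vec d) (k : ℕ) :
    saInterp a x (saTime a k) = x k := by
  rw [saInterp_of_mem_Ico ha x (left_mem_Ico.2 (saTime_strictMono ha k.lt_succ_self))]
  simp

theorem saInterp_of_mem_Icc (ha : ∀ k, 0 < a k) (x : ℕ → Vec d) {k : ℕ}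
    (hs : s ∈ Icc (saTime a k) (saTime a (k + 1))) :
    saInterp a x s = x k + ((s - saTime a k) / a k) • (x (k + 1) - x k) := by
  rcases hs.2.lt_or_eq with hlt | rfl
  · exact saInterp_of_mem_Ico ha x ⟨hs.1, hlt⟩
  · rw [saInterp_saTime ha, saTime_succ, add_sub_cancel_left, div_self (ha k).ne', one_smul,
      add_sub_cancel]

theorem continuousOn_saInterp (ha : ∀ k, 0 < a k) (x : ℕ → Vec d) (k : ℕ) :
    ContinuousOn (saInterp a x) (Icc (saTime a k) (saTime a (k + 1))) := by
  refine ContinuousOn.congr (f := fun s => x k + ((s - saTime a k) / a k) • (x (k + 1) - x k))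
    ?_ fun s hs => saInterp_of_mem_Icc ha x hs
  fun_prop

theorem hasDerivAt_saInterp (ha : ∀ k, 0 < a k) (x : ℕ → Vec d) {k : ℕ}
    (hs : s ∈ Ioo (saTime a k) (saTime a (k + 1))) :
    HasDerivAt (saInterp a x) ((a k)⁻¹ • (x (k + 1) - x k)) s := by
  have h1 : HasDerivAt (fun s => x k + ((s - saTime a k) / a k) • (x (k + 1) - x k))
      ((1 / a k) • (x (k + 1) - x k)) s :=
    ((((hasDerivAt_id s).sub_const _).div_const _).smul_const _).const_add _
  rw [one_div] at h1
  refine h1.congr_of_eventuallyEq ?_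
  filter_upwards [Ioo_mem_nhds hs.1 hs.2] with r hr
  exact saInterp_of_mem_Icc ha x (Ioo_subset_Icc_self hr)

end Interpolation

/-! ### The decomposition of the interpolated path -/

section Decomposition

variable {d : ℕ} {h : Vec d → Vec d} {a : ℕ → ℝ} {x m : ℕ → Vec d} {n₀ n k : ℕ}

theorem intervalIntegrable_fundMatrix_saInterp (hh : ContDiff ℝ 2 h) (ha : ∀ k, 0 < a k)
    (hk : k < n) (H : ∀ s ∈ Icc (saTime a k) (saTime a (k + 1)),
      HasODESolution h s (saTime a n) (saInterp a x s)) :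
    IntervalIntegrable (fun s => fundMatrix h (saTime a n) s (saInterp a x s))
      volume (saTime a k) (saTime a (k + 1)) :=
  (continuousOn_fundMatrix_comp hh ((saTime_strictMono ha).monotone hk)
    (continuousOn_saInterp ha x k) H).intervalIntegrable_of_Icc
      ((saTime_strictMono ha).monotone k.le_succ)

theorem intervalIntegrable_fundMatrix_discretization (hh : ContDiff ℝ 2 h) (ha : ∀ k, 0 < a k)
    (hk : k < n) (H : ∀ s ∈ Icc (saTime a k) (saTime a (k + 1)),
      HasODESolution h s (saTime a n) (saInterp a x s)) :
    IntervalIntegrable (fun s => fundMatrix h (saTime a n) s (saInterp a x s)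
        (h (saInterp a x (saTime a k)) - h (saInterp a x s)))
      volume (saTime a k) (saTime a (k + 1)) :=
  ((continuousOn_fundMatrix_comp hh ((saTime_strictMono ha).monotone hk)
    (continuousOn_saInterp ha x k) H).clm_apply (continuousOn_const.sub
      (hh.continuous.comp_continuousOn (continuousOn_saInterp ha x k)))).intervalIntegrable_of_Icc
        ((saTime_strictMono ha).monotone k.le_succ)

theorem HasODESolution.of_start_le {s s' T : ℝ} {u : Vec d} (H : HasODESolution h s T u)
    (hs : s ≤ s') : HasODESolution h s' T u :=
  hasODESolution_iff_zero_sub.2 ((hasODESolution_iff_zero_sub.1 H).mono (by linarith))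

theorem intervalIntegrable_fundMatrix_const (hh : ContDiff ℝ 2 h) (ha : ∀ k, 0 < a k)
    (hk : k < n) {u : Vec d} (H : HasODESolution h (saTime a k) (saTime a n) u) :
    IntervalIntegrable (fun s => fundMatrix h (saTime a n) s u)
      volume (saTime a k) (saTime a (k + 1)) :=
  (continuousOn_fundMatrix_comp hh ((saTime_strictMono ha).monotone hk)
    continuousOn_const fun _ hs => H.of_start_le hs.1).intervalIntegrable_of_Icc
      ((saTime_strictMono ha).monotone k.le_succ)

/-- Alekseev's formula on one step of the scheme, where the defect `ẋ̄ - h(x̄)` of the interpolated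
path is the discretization error plus the noise. -/
theorem odeSol_saInterp_succ_sub (hh : ContDiff ℝ 2 h) (ha : ∀ k, 0 < a k)
    (hx : x (k + 1) = x k + a k • (h (x k) + m (k + 1))) (hk : k < n)
    (H : ∀ s ∈ Icc (saTime a k) (saTime a (k + 1)),
      HasODESolution h s (saTime a n) (saInterp a x s)) :
    odeSol h (saTime a n) (saTime a (k + 1)) (saInterp a x (saTime a (k + 1))) -
        odeSol h (saTime a n) (saTime a k) (saInterp a x (saTime a k)) =
      (∫ s in (saTime a k)..(saTime a (k + 1)), fundMatrix h (saTime a n) s (saInterp a x s)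
        (h (saInterp a x (saTime a k)) - h (saInterp a x s))) +
      (∫ s in (saTime a k)..(saTime a (k + 1)),
        fundMatrix h (saTime a n) s (saInterp a x s)) (m (k + 1)) := by
  have hint := intervalIntegrable_fundMatrix_saInterp hh ha hk H
  have hintm : IntervalIntegrable
      (fun s => fundMatrix h (saTime a n) s (saInterp a x s) (m (k + 1)))
      volume (saTime a k) (saTime a (k + 1)) :=
    ⟨hint.1.apply_continuousLinearMap _, hint.2.apply_continuousLinearMap _⟩
  have hintd := intervalIntegrable_fundMatrix_discretization hh ha hk H
  have hslope : (a k)⁻¹ • (x (k + 1) - x k) = h (saInterp a x (saTime a k)) + m (k + 1) := by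
    rw [hx, add_sub_cancel_left, inv_smul_smul₀ (ha k).ne', saInterp_saTime ha]
  have hsplit : ∀ s, fundMatrix h (saTime a n) s (saInterp a x s)
        ((a k)⁻¹ • (x (k + 1) - x k) - h (saInterp a x s)) =
      fundMatrix h (saTime a n) s (saInterp a x s)
        (h (saInterp a x (saTime a k)) - h (saInterp a x s)) +
      fundMatrix h (saTime a n) s (saInterp a x s) (m (k + 1)) := fun s => by
    rw [hslope, ← map_add]; congr 1; abel
  rw [ContinuousLinearMap.intervalIntegral_apply hint, ← intervalIntegral.integral_add hintd hintm,
    ← integral_fundMatrix_eq_odeSol_sub hh ((saTime_strictMono ha).monotone k.le_succ)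
      ((saTime_strictMono ha).monotone hk) (continuousOn_saInterp ha x k)
      (fun s hs => (hasDerivAt_saInterp ha x hs).hasDerivWithinAt) H]
  · exact intervalIntegral.integral_congr fun s _ => hsplit s
  · simpa only [hsplit] using hintd.add hintm

theorem saInterp_eq_odeSol_add (hh : ContDiff ℝ 2 h) (ha : ∀ k, 0 < a k)
    (hx : ∀ k, x (k + 1) = x k + a k • (h (x k) + m (k + 1))) (hn : n₀ ≤ n)
    (H : ∀ s ∈ Icc (saTime a n₀) (saTime a n),
      HasODESolution h s (saTime a n) (saInterp a x s)) :
    saInterp a x (saTime a n) =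
      odeSol h (saTime a n) (saTime a n₀) (saInterp a x (saTime a n₀)) +
        discTerm h a x n₀ n + noiseTerm h a x m n₀ n := by
  have hsum : discTerm h a x n₀ n + noiseTerm h a x m n₀ n =
      ∑ k ∈ Finset.Ico n₀ n,
        (odeSol h (saTime a n) (saTime a (k + 1)) (saInterp a x (saTime a (k + 1))) -
          odeSol h (saTime a n) (saTime a k) (saInterp a x (saTime a k))) := by
    rw [discTerm, noiseTerm, ← Finset.sum_add_distrib]
    refine Finset.sum_congr rfl fun k hk => ?_
    rw [Finset.mem_Ico] at hk
    refine (odeSol_saInterp_succ_sub hh ha (hx k) hk.2 fun s hs => H s ?_).symm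
    have hmono := (saTime_strictMono ha).monotone
    exact ⟨(hmono hk.1).trans hs.1, hs.2.trans (hmono hk.2)⟩
  rw [add_assoc, hsum, Finset.sum_Ico_sub
    (fun k => odeSol h (saTime a n) (saTime a k) (saInterp a x (saTime a k))) hn,
    odeSol_self (hh.of_le one_le_two)]
  abel

end Decomposition

/-! ### The noise coefficients and measurability along the scheme -/

section NoiseCoefficient

variable {d : ℕ} {h : Vec d → Vec d} {a : ℕ → ℝ} {n k : ℕ}

/-- The matrix `∫ Φ(t_n, s, u) ds` over `[t_k, t_{k+1}]` multiplying `M_{k+1}` in the `k`-th summand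
of `S_n` when `x_k = u`. -/
noncomputable def noiseCoeff (h : Vec d → Vec d) (a : ℕ → ℝ) (n k : ℕ) (u : Vec d) :
    Vec d →L[ℝ] Vec d :=
  ∫ s in (saTime a k)..(saTime a (k + 1)), fundMatrix h (saTime a n) s u

theorem mgDiff_eq_noiseCoeff_apply (ha : ∀ k, 0 < a k) (x m : ℕ → Vec d) :
    mgDiff h a x m n k = noiseCoeff h a n k (x k) (m (k + 1)) := by
  rw [mgDiff, noiseCoeff, saInterp_saTime ha]

/-- Clamping time to `[t_k, t_{k+1}]` makes the integrand continuous on a full product space. -/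
theorem continuousOn_noiseCoeff (hh : ContDiff ℝ 2 h) (ha : ∀ k, 0 < a k) (hk : k < n) :
    ContinuousOn (noiseCoeff h a n k)
      {u | HasODESolution h (saTime a k) (saTime a n) u} := by
  have hmono := (saTime_strictMono ha).monotone
  have hle : saTime a k ≤ saTime a (k + 1) := hmono k.le_succ
  have hle' : saTime a (k + 1) ≤ saTime a n := hmono hk
  rw [continuousOn_iff_continuous_domRestrict]
  let D := {u | HasODESolution h (saTime a k) (saTime a n) u}
  let f : D → ℝ → (Vec d →L[ℝ] Vec d) := fun u s =>
    fundMatrix h (saTime a n - projIcc _ _ hle s) 0 u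
  have hf : Continuous (Function.uncurry f) := by
    refine (continuousOn_fundMatrix_flowDomain hh).comp_continuous
      (f := fun p : D × ℝ => (saTime a n - projIcc _ _ hle p.2, (p.1 : Vec d))) ?_ fun p => ?_
    · exact (continuous_const.sub (continuous_subtype_val.comp
        (continuous_projIcc.comp continuous_snd))).prodMk
          (continuous_subtype_val.comp continuous_fst)
    · have hp := (projIcc _ _ hle p.2).2
      exact ⟨sub_nonneg.2 (hp.2.trans hle'),
        hasODESolution_iff_zero_sub.1 (HasODESolution.of_start_le p.1.2 hp.1)⟩
  have hint := intervalIntegral.continuous_parametric_intervalIntegral_of_continuous' (μ := volume)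
    hf (saTime a k) (saTime a (k + 1))
  convert! hint using 2 with u
  refine intervalIntegral.integral_congr fun s hs => ?_
  rw [uIcc_of_le hle] at hs
  simp only [f, projIcc_of_mem hle hs]
  exact fundMatrix_eq_zero_sub (hh.of_le one_le_two) (hs.2.trans hle')
    (HasODESolution.of_start_le u.2 hs.1)

/-- Off the open set of admissible starting points nothing is known of the coefficient, so it is
cut off there. -/
theorem stronglyMeasurable_indicator_noiseCoeff (hh : ContDiff ℝ 2 h) (ha : ∀ k, 0 < a k)
    (hk : k < n) :
    StronglyMeasurable ({u | HasODESolution h (saTime a k) (saTime a n) u}.indicator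
      (noiseCoeff h a n k)) := by
  classical
  have hopen := isOpen_setOf_hasODESolution hh ((saTime_strictMono ha).monotone hk.le)
    (s := saTime a k)
  refine Measurable.stronglyMeasurable ?_
  rw [← piecewise_eq_indicator]
  exact (continuousOn_noiseCoeff hh ha hk).measurable_piecewise continuousOn_const
    hopen.measurableSet

theorem indicator_mgDiff_eq {Ω : Type*} (ha : ∀ k, 0 < a k) (x : Ω → ℕ → Vec d)
    (M : ℕ → Ω → Vec d) (A : Set Ω) :
    (A.indicator fun ω => mgDiff h a (x ω) (fun j => M j ω) n k) =
      fun ω => ContinuousLinearMap.id ℝ (Vec d →L[ℝ] Vec d)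
        (A.indicator (fun ω => noiseCoeff h a n k (x ω k)) ω) (M (k + 1) ω) := by
  funext ω
  by_cases hω : ω ∈ A <;> simp [hω, mgDiff_eq_noiseCoeff_apply ha]

end NoiseCoefficient

section Scheme

variable {d : ℕ} {Ω : Type*} [mΩ : MeasurableSpace Ω] {P : Measure Ω}
  {h : Vec d → Vec d} {a : ℕ → ℝ} {x₀ : Ω → Vec d} {M : ℕ → Ω → Vec d}
  {hx₀ : Measurable x₀} {hM : ∀ n, Measurable (M (n + 1))} {n k : ℕ} {A : Set Ω}

theorem measurable_noise_saFiltration {j l : ℕ} (hjl : j < l) :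
    Measurable[saFiltration x₀ M hx₀ hM l] (M (j + 1)) := by
  rw [measurable_iff_comap_le]
  exact le_trans (le_iSup₂_of_le (f := fun i (_ : i < l) =>
    MeasurableSpace.comap (M (i + 1)) inferInstance) j hjl le_rfl) le_sup_right

theorem measurable_saIterate (hh : Measurable h) (k : ℕ) :
    Measurable[saFiltration x₀ M hx₀ hM k]
      (fun ω => saIterate h a (x₀ ω) (fun j => M j ω) k) := by
  induction k with
  | zero =>
    rw [measurable_iff_comap_le]
    exact le_sup_left
  | succ k ih =>
    have ih' := ih.mono ((saFiltration x₀ M hx₀ hM).mono k.le_succ) le_rfl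
    have hMk := measurable_noise_saFiltration (hx₀ := hx₀) (hM := hM) k.lt_succ_self
    exact ih'.add (((hh.comp ih').add hMk).const_smul (a k))

variable {x : Ω → ℕ → Vec d}

theorem stronglyMeasurable_indicator_noiseCoeff_comp (hh : ContDiff ℝ 2 h) (ha : ∀ k, 0 < a k)
    (hxm : Measurable[saFiltration x₀ M hx₀ hM k] fun ω => x ω k) (hk : k < n)
    (hA : MeasurableSet[saFiltration x₀ M hx₀ hM k] A)
    (hAD : ∀ ω ∈ A, HasODESolution h (saTime a k) (saTime a n) (x ω k)) :
    StronglyMeasurable[saFiltration x₀ M hx₀ hM k]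
      (A.indicator fun ω => noiseCoeff h a n k (x ω k)) := by
  have h1 := ((stronglyMeasurable_indicator_noiseCoeff hh ha hk).comp_measurable hxm).indicator hA
  convert! h1 using 1
  funext ω
  by_cases hω : ω ∈ A
  · have hD : x ω k ∈ {u | HasODESolution h (saTime a k) (saTime a n) u} := hAD ω hω
    simp only [indicator_of_mem hω, Function.comp_apply, indicator_of_mem hD]
  · simp only [indicator_of_notMem hω]

theorem stronglyMeasurable_indicator_mgDiff (hh : ContDiff ℝ 2 h) (ha : ∀ k, 0 < a k)
    (hxm : Measurable[saFiltration x₀ M hx₀ hM k] fun ω => x ω k) (hk : k < n)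
    (hA : MeasurableSet[saFiltration x₀ M hx₀ hM k] A)
    (hAD : ∀ ω ∈ A, HasODESolution h (saTime a k) (saTime a n) (x ω k)) :
    StronglyMeasurable[saFiltration x₀ M hx₀ hM (k + 1)]
      (A.indicator fun ω => mgDiff h a (x ω) (fun j => M j ω) n k) := by
  rw [indicator_mgDiff_eq ha x M A]
  have h1 := (stronglyMeasurable_indicator_noiseCoeff_comp hh ha hxm hk hA hAD).mono
    ((saFiltration x₀ M hx₀ hM).mono k.le_succ)
  have h2 := (measurable_noise_saFiltration (hx₀ := hx₀) (hM := hM)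
    k.lt_succ_self).stronglyMeasurable
  exact isBoundedBilinearMap_apply.continuous.comp_stronglyMeasurable (h1.prodMk h2)

/-- The coefficient of `M_{k+1}` is known at time `k`, so it is pulled out of the conditional
expectation; only the integrability of the product is needed. -/
theorem condExp_indicator_mgDiff (hh : ContDiff ℝ 2 h) (ha : ∀ k, 0 < a k)
    (hxm : Measurable[saFiltration x₀ M hx₀ hM k] fun ω => x ω k) (hk : k < n)
    (hMint : Integrable (M (k + 1)) P)
    (hMd : P[M (k + 1) | saFiltration x₀ M hx₀ hM k] =ᵐ[P] 0)
    (hA : MeasurableSet[saFiltration x₀ M hx₀ hM k] A)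
    (hAD : ∀ ω ∈ A, HasODESolution h (saTime a k) (saTime a n) (x ω k))
    (hint : Integrable (A.indicator fun ω => mgDiff h a (x ω) (fun j => M j ω) n k) P) :
    P[A.indicator fun ω => mgDiff h a (x ω) (fun j => M j ω) n k |
      saFiltration x₀ M hx₀ hM k] =ᵐ[P] 0 := by
  rw [indicator_mgDiff_eq ha x M A] at hint ⊢
  refine (condExp_bilin_of_stronglyMeasurable_left _
    (stronglyMeasurable_indicator_noiseCoeff_comp hh ha hxm hk hA hAD) hint hMint).trans ?_
  filter_upwards [hMd] with ω hω
  rw [hω]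
  exact map_zero _

theorem integrable_indicator_mgDiff (hh : ContDiff ℝ 2 h) (ha : ∀ k, 0 < a k)
    (hxm : Measurable[saFiltration x₀ M hx₀ hM k] fun ω => x ω k) (hk : k < n)
    (hMint : Integrable (M (k + 1)) P) {K : Set (Vec d)} (hK : IsCompact K)
    (hKD : ∀ u ∈ K, HasODESolution h (saTime a k) (saTime a n) u)
    (hA : MeasurableSet[saFiltration x₀ M hx₀ hM k] A) (hAK : ∀ ω ∈ A, x ω k ∈ K) :
    Integrable (A.indicator fun ω => mgDiff h a (x ω) (fun j => M j ω) n k) P := by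
  rw [indicator_mgDiff_eq ha x M A]
  obtain ⟨C, hC⟩ := hK.exists_bound_of_continuousOn
    ((continuousOn_noiseCoeff hh ha hk).mono hKD)
  have hmeas := (stronglyMeasurable_indicator_noiseCoeff_comp hh ha hxm hk hA
    fun ω hω => hKD _ (hAK ω hω)).mono ((saFiltration x₀ M hx₀ hM).le k)
  refine ContinuousLinearMap.integrable_of_bilin_of_bdd_left _ (max C 0)
    hmeas.aestronglyMeasurable (Filter.Eventually.of_forall fun ω => ?_) hMint
  by_cases hω : ω ∈ A
  · rw [indicator_of_mem hω]
    exact (hC _ (hAK ω hω)).trans (le_max_left _ _)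
  · rw [indicator_of_notMem hω, norm_zero]
    exact le_max_right _ _

/-- The open set of admissible starting points is an increasing union of compact sets; the events
are the preimages of these. -/
theorem exists_monotone_events_integrable_mgDiff (hh : ContDiff ℝ 2 h) (ha : ∀ k, 0 < a k)
    (hxm : Measurable[saFiltration x₀ M hx₀ hM k] fun ω => x ω k) (hk : k < n)
    (hMint : Integrable (M (k + 1)) P) :
    ∃ B : ℕ → Set Ω, Monotone B ∧
      (∀ j, MeasurableSet[saFiltration x₀ M hx₀ hM k] (B j)) ∧
      (⋃ j, B j) = {ω | HasODESolution h (saTime a k) (saTime a n) (x ω k)} ∧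
      ∀ j, Integrable
        ((B j).indicator fun ω => mgDiff h a (x ω) (fun i => M i ω) n k) P := by
  have hopen := isOpen_setOf_hasODESolution hh ((saTime_strictMono ha).monotone hk.le)
    (s := saTime a k)
  obtain ⟨F, hFc, hFs, hFU, hFm⟩ := hopen.exists_iUnion_isClosed
  let K : ℕ → Set (Vec d) := fun j => F j ∩ Metric.closedBall 0 j
  have hKc : ∀ j, IsCompact (K j) := fun j => (isCompact_closedBall _ _).inter_left (hFc j)
  have hKm : Monotone K := fun i j hij =>
    inter_subset_inter (hFm hij) (Metric.closedBall_subset_closedBall (Nat.cast_le.2 hij))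
  have hKU : (⋃ j, K j) = {u | HasODESolution h (saTime a k) (saTime a n) u} := by
    have hball : Monotone fun j : ℕ => Metric.closedBall (0 : Vec d) j := fun i j hij =>
      Metric.closedBall_subset_closedBall (Nat.cast_le.2 hij)
    rw [← hFU]
    exact (iUnion_inter_of_monotone hFm hball).trans
      (by rw [Metric.iUnion_closedBall_nat, inter_univ])
  refine ⟨fun j => (fun ω => x ω k) ⁻¹' K j, fun i j hij => preimage_mono (hKm hij),
    fun j => hxm (hKc j).measurableSet, ?_, fun j => ?_⟩
  · rw [← preimage_iUnion, hKU]
    rfl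
  · exact integrable_indicator_mgDiff hh ha hxm hk hMint (hKc j) (fun u hu => hFs j hu.1)
      (hxm (hKc j).measurableSet) fun ω hω => hω

end Scheme

/-- Sums of martingale differences form a martingale, here with the summation confined
to `n₀ ≤ k < n`. -/
theorem martingale_sum_Ico_min {Ω E : Type*} [mΩ : MeasurableSpace Ω] {P : Measure Ω}
    [IsFiniteMeasure P] [NormedAddCommGroup E] [NormedSpace ℝ E] [CompleteSpace E]
    {ℱ : Filtration ℕ mΩ} {n₀ n : ℕ} {ξ : ℕ → Ω → E}
    (hξm : ∀ k ∈ Finset.Ico n₀ n, StronglyMeasurable[ℱ (k + 1)] (ξ k))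
    (hξi : ∀ k ∈ Finset.Ico n₀ n, Integrable (ξ k) P)
    (hξ0 : ∀ k ∈ Finset.Ico n₀ n, P[ξ k | ℱ k] =ᵐ[P] 0) :
    Martingale (fun (l : ℕ) (ω : Ω) => ∑ k ∈ Finset.Ico n₀ (min l n), ξ k ω) ℱ P := by
  have hmem : ∀ {l k : ℕ}, k ∈ Finset.Ico n₀ (min l n) → k ∈ Finset.Ico n₀ n ∧ k + 1 ≤ l := by
    intro l k hk
    rw [Finset.mem_Ico, lt_min_iff] at hk
    exact ⟨Finset.mem_Ico.2 ⟨hk.1, hk.2.2⟩, hk.2.1⟩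
  refine martingale_of_condExp_sub_eq_zero_nat (fun l => ?_) (fun l => ?_) fun l => ?_
  · exact Finset.stronglyMeasurable_fun_sum _ fun k hk =>
      (hξm k (hmem hk).1).mono (ℱ.mono (hmem hk).2)
  · exact integrable_finsetSum _ fun k hk => hξi k (hmem hk).1
  · by_cases hl : l ∈ Finset.Ico n₀ n
    · have hl' := Finset.mem_Ico.1 hl
      have hstep : ((fun ω => ∑ k ∈ Finset.Ico n₀ (min (l + 1) n), ξ k ω) -
          fun ω => ∑ k ∈ Finset.Ico n₀ (min l n), ξ k ω) = ξ l := by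
        funext ω
        rw [Pi.sub_apply, min_eq_left hl'.2, min_eq_left hl'.2.le, Finset.sum_Ico_succ_top hl'.1,
          add_sub_cancel_left]
      rw [hstep]
      exact hξ0 l hl
    · have hstep : ((fun ω => ∑ k ∈ Finset.Ico n₀ (min (l + 1) n), ξ k ω) -
          fun ω => ∑ k ∈ Finset.Ico n₀ (min l n), ξ k ω) = 0 := by
        have : Finset.Ico n₀ (min (l + 1) n) = Finset.Ico n₀ (min l n) := by
          ext k
          simp only [Finset.mem_Ico, lt_min_iff] at hl ⊢
          omega
        rw [this, sub_self]
      rw [hstep, condExp_zero]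

/-! ### The decomposition and the martingale differences of the scheme -/

theorem mainTheorem6 {d : ℕ} {Ω : Type*} [mΩ : MeasurableSpace Ω] (P : Measure Ω)
    [IsProbabilityMeasure P]
    (h : Vec d → Vec d) (hh : ContDiff ℝ 2 h)
    (a : ℕ → ℝ) (ha : ∀ n, 0 < a n)
    (x₀ : Ω → Vec d) (M : ℕ → Ω → Vec d)
    (hx₀ : Measurable x₀) (hM : ∀ n, Measurable (M (n + 1)))
    (hMint : ∀ n, Integrable (M (n + 1)) P)
    (hMd : ∀ n, P[M (n + 1) | saFiltration x₀ M hx₀ hM n] =ᵐ[P] 0)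
    (x : Ω → ℕ → Vec d) (hx : ∀ ω, x ω = saIterate h a (x₀ ω) (fun k => M k ω))
    (n₀ n : ℕ) (hn : n₀ ≤ n) :
    -- `x(·, s, u)` and `Φ(·, s, u)` solve their equations wherever the former exists
    (∀ (s T : ℝ) (u : Vec d), s ≤ T → HasODESolution h s T u →
      IsODESolution h s T u (fun t => odeSol h t s u) ∧
      IsFundamentalSolution h s T u (fun t => fundMatrix h t s u)) ∧
    -- the decomposition, path by path
    (∀ ω, (∀ s ∈ Icc (saTime a n₀) (saTime a n),
        HasODESolution h s (saTime a n) (saInterp a (x ω) s)) →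
      (∀ k ∈ Finset.Ico n₀ n,
        IntervalIntegrable
          (fun s => fundMatrix h (saTime a n) s (saInterp a (x ω) s)
            (h (saInterp a (x ω) (saTime a k)) - h (saInterp a (x ω) s)))
          volume (saTime a k) (saTime a (k + 1)) ∧
        IntervalIntegrable (fun s => fundMatrix h (saTime a n) s (saInterp a (x ω) s))
          volume (saTime a k) (saTime a (k + 1)) ∧
        IntervalIntegrable
          (fun s => fundMatrix h (saTime a n) s (saInterp a (x ω) (saTime a k)))
          volume (saTime a k) (saTime a (k + 1))) ∧
      saInterp a (x ω) (saTime a n) =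
        odeSol h (saTime a n) (saTime a n₀) (saInterp a (x ω) (saTime a n₀)) +
          discTerm h a (x ω) n₀ n + mgTerm h a (x ω) (fun k => M k ω) n₀ n +
          (noiseTerm h a (x ω) (fun k => M k ω) n₀ n -
            mgTerm h a (x ω) (fun k => M k ω) n₀ n)) ∧
    -- the summands of `S_n` are martingale differences, on all events where they are
    -- defined and integrable
    (∀ A : ℕ → Set Ω,
      (∀ k ∈ Finset.Ico n₀ n, MeasurableSet[saFiltration x₀ M hx₀ hM k] (A k)) →
      (∀ k ∈ Finset.Ico n₀ n, ∀ ω ∈ A k,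
        HasODESolution h (saTime a k) (saTime a n) (x ω k)) →
      (∀ k ∈ Finset.Ico n₀ n,
        Integrable ((A k).indicator fun ω => mgDiff h a (x ω) (fun j => M j ω) n k) P) →
      (∀ k ∈ Finset.Ico n₀ n,
        StronglyMeasurable[saFiltration x₀ M hx₀ hM (k + 1)]
          ((A k).indicator fun ω => mgDiff h a (x ω) (fun j => M j ω) n k) ∧
        P[(A k).indicator fun ω => mgDiff h a (x ω) (fun j => M j ω) n k |
          saFiltration x₀ M hx₀ hM k] =ᵐ[P] 0) ∧
      Martingale
        (fun (l : ℕ) (ω : Ω) => ∑ k ∈ Finset.Ico n₀ (min l n),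
          (A k).indicator (fun ω => mgDiff h a (x ω) (fun j => M j ω) n k) ω)
        (saFiltration x₀ M hx₀ hM) P) ∧
    -- integrability holds when `x_k` is confined to a compact set of admissible points
    (∀ k ∈ Finset.Ico n₀ n, ∀ (K : Set (Vec d)) (A : Set Ω), IsCompact K →
      (∀ u ∈ K, HasODESolution h (saTime a k) (saTime a n) u) →
      MeasurableSet[saFiltration x₀ M hx₀ hM k] A → (∀ ω ∈ A, x ω k ∈ K) →
      Integrable (A.indicator fun ω => mgDiff h a (x ω) (fun j => M j ω) n k) P) ∧
    -- such events exhaust the event on which the summand is defined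
    (∀ k ∈ Finset.Ico n₀ n, ∃ B : ℕ → Set Ω, Monotone B ∧
      (∀ j, MeasurableSet[saFiltration x₀ M hx₀ hM k] (B j)) ∧
      (⋃ j, B j) = {ω | HasODESolution h (saTime a k) (saTime a n) (x ω k)} ∧
      ∀ j, Integrable
        ((B j).indicator fun ω => mgDiff h a (x ω) (fun i => M i ω) n k) P) := by
  have hh1 : ContDiff ℝ 1 h := hh.of_le one_le_two
  have hxm : ∀ k, Measurable[saFiltration x₀ M hx₀ hM k] fun ω => x ω k := fun k => by
    simp only [hx]
    exact measurable_saIterate hh.continuous.measurable k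
  have hlt : ∀ k ∈ Finset.Ico n₀ n, k < n := fun k hk => (Finset.mem_Ico.1 hk).2
  refine ⟨fun s T u hsT H => ⟨H.isODESolution_odeSol hh1 hsT,
    H.isFundamentalSolution_fundMatrix hh1 hsT⟩, fun ω H => ⟨fun k hk => ?_, ?_⟩,
    fun A hA hAD hAint => ?_, fun k hk K A hK hKD hA hAK => ?_, fun k hk => ?_⟩
  · have hmono := (saTime_strictMono ha).monotone
    have hk' := Finset.mem_Ico.1 hk
    have Hk : ∀ s ∈ Icc (saTime a k) (saTime a (k + 1)),
        HasODESolution h s (saTime a n) (saInterp a (x ω) s) := fun s hs =>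
      H s ⟨(hmono hk'.1).trans hs.1, hs.2.trans (hmono hk'.2)⟩
    exact ⟨intervalIntegrable_fundMatrix_discretization hh ha hk'.2 Hk,
      intervalIntegrable_fundMatrix_saInterp hh ha hk'.2 Hk,
      intervalIntegrable_fundMatrix_const hh ha hk'.2
        (Hk _ (left_mem_Icc.2 (hmono k.le_succ)))⟩
  · rw [add_assoc _ (mgTerm _ _ _ _ _ _), add_sub_cancel]
    exact saInterp_eq_odeSol_add hh ha (fun k => by rw [hx]; rfl) hn H
  · have hmeas := fun k hk => stronglyMeasurable_indicator_mgDiff hh ha (hxm k) (hlt k hk)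
      (hA k hk) (hAD k hk)
    have hcond := fun k hk => condExp_indicator_mgDiff hh ha (hxm k) (hlt k hk) (hMint k)
      (hMd k) (hA k hk) (hAD k hk) (hAint k hk)
    exact ⟨fun k hk => ⟨hmeas k hk, hcond k hk⟩, martingale_sum_Ico_min hmeas hAint hcond⟩
  · exact integrable_indicator_mgDiff hh ha (hxm k) (hlt k hk) (hMint k) hK hKD hA hAK
  · exact exists_monotone_events_integrable_mgDiff hh ha (hxm k) (hlt k hk) (hMint k)
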